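/- Let $V\in L^\infty(\mathbb R)$ be real-valued with $v_0\le V(x)\le v_1$ for a.e. $x\in\mathbb R$, where $v_0>0$ and $v_1$ are constants. Elements of the real Sobolev space $H^1(\mathbb R)$ are identified with their continuous representatives, and for $u,v\in H^1(\mathbb R)$ put $$(u,v)_V=\int_{\mathbb R}\bigl(u'(x)v'(x)+V(x)u(x)v(x)\bigr)\,dx .$$ For $a\in\mathbb R$ let $K_a=\{u\in H^1(\mathbb R): u(a)=\|u\|_{L^\infty(\mathbb R)}=1\}$. Call $G:\mathbb R\times\mathbb R\to\mathbb R$ a Green function of $L=-\frac{d^2}{dx^2}+V$ if for every $y\in\mathbb R$ the function $G(\cdot,y)$ lies in $H^1(\mathbb R)$ and $L\,G(\cdot,y)=\delta_y$ in $H^{-1}(\mathbb R)$, that is, $(G(\cdot,y),v)_V=v(y)$ for all $v\in H^1(\mathbb R)$. Then for every $a\in\mathbb R$ the functional $u\mapsto (u,u)_V$ has a unique minimizer $u_a$ on $K_a$; the one-sided derivatives $u_a'(a_-)$ and $u_a'(a_+)$ of $u_a$ at $a$ exist, and $u_a'(a_-)-u_a'(a_+)\neq 0$. Moreover $L$ has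 exactly one Green function $G$, and $$G(x,y)=\frac{u_y(x)}{u_y'(y_-)-u_y'(y_+)}=\frac{u_x(y)}{u_x'(x_-)-u_x'(x_+)}\qquad (x,y\in\mathbb R).$$ In particular $G(x,y)=G(y,x)$ for all $x,y\in\mathbb R$. -/

import Mathlib

open MeasureTheory Set
open scoped ContDiff

/-- `g` is a weak derivative of `u` on the real line. -/
def HasWeakDeriv (u g : ℝ → ℝ) : Prop :=
  LocallyIntegrable u volume ∧ LocallyIntegrable g volume ∧
    ∀ φ : ℝ → ℝ, ContDiff ℝ ∞ φ → HasCompactSupport φ →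
      ∫ x, u x * deriv φ x = -∫ x, g x * φ x

/-- Weak derivatives are unique up to null sets. -/
theorem HasWeakDeriv.ae_eq {u g h : ℝ → ℝ} (hg : HasWeakDeriv u g) (hh : HasWeakDeriv u h) :
    ∀ᵐ x, g x = h x := by
  refine ae_eq_of_integral_contDiff_smul_eq hg.2.1 hh.2.1 fun φ hφ hc => ?_
  have h1 := hg.2.2 φ hφ hc
  have h2 := hh.2.2 φ hφ hc
  simp only [smul_eq_mul, mul_comm (φ _)]
  linarith

open Classical in
/-- A representative of the weak derivative of `u` (zero if there is none). By
`HasWeakDeriv.ae_eq` the choice is irrelevant up to null sets. -/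
noncomputable def weakDeriv (u : ℝ → ℝ) : ℝ → ℝ :=
  if h : ∃ g, HasWeakDeriv u g then h.choose else 0

/-- `u ∈ H¹(ℝ)`, each element being represented by its continuous representative. -/
def MemH1 (u : ℝ → ℝ) : Prop :=
  Continuous u ∧ MemLp u 2 volume ∧ ∃ g, HasWeakDeriv u g ∧ MemLp g 2 volume

/-- The inner product `(u, v)_V = ∫ (u' v' + V u v) dx` on `H¹(ℝ)`. -/
noncomputable def innerV (V u v : ℝ → ℝ) : ℝ :=
  ∫ x, (weakDeriv u x * weakDeriv v x + V x * u x * v x)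

/-- The set `K_a = {u ∈ H¹(ℝ) : u(a) = ‖u‖_∞ = 1}`. -/
def peakSet (a : ℝ) : Set (ℝ → ℝ) :=
  {u | MemH1 u ∧ u a = 1 ∧ eLpNorm u ⊤ volume = 1}

/-- `u` minimizes `‖·‖_V²` over `K_a`. -/
def IsPeakMinimizer (V : ℝ → ℝ) (a : ℝ) (u : ℝ → ℝ) : Prop :=
  u ∈ peakSet a ∧ ∀ w ∈ peakSet a, innerV V u u ≤ innerV V w w

/-- The operator `L = -d²/dx² + V : H¹(ℝ) → H⁻¹(ℝ)`, written through its duality pairing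
`⟨L u, v⟩ = (u, v)_V` with `v ∈ H¹(ℝ)`. -/
noncomputable def schrodingerOp (V u : ℝ → ℝ) : (ℝ → ℝ) → ℝ := fun v => innerV V u v

/-- The Dirac distribution at `y`, as a functional on `H¹(ℝ)` (continuous representatives). -/
def diracFunctional (y : ℝ) : (ℝ → ℝ) → ℝ := fun v => v y

/-- `G` is a Green function of `L = -d²/dx² + V`: for every `y`, the function `G(·, y)` lies in
`H¹(ℝ)` and satisfies `L G(·, y) = δ_y` in `H⁻¹(ℝ)`. -/
def IsGreenFunction (V : ℝ → ℝ) (G : ℝ → ℝ → ℝ) : Prop :=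
  ∀ y, MemH1 (fun x => G x y) ∧
    ∀ v, MemH1 v → schrodingerOp V (fun x => G x y) v = diracFunctional y v

/-- The jump `u'(a-) - u'(a+)` of the one-sided derivatives of `u` at `a`. -/
noncomputable def derivJump (u : ℝ → ℝ) (a : ℝ) : ℝ :=
  derivWithin u (Iio a) a - derivWithin u (Ioi a) a

/-! Everything follows from the function `h a` in H¹ with (h_a, v)_V = v(a) for all v, which is
unique because the form is positive definite. Existence (`exists_representer`) is the Riesz theorem,
carried out in L² × L² rather than in a Hilbert space built from H¹. Weakly h_a'' = V h_a - δ_a, so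
h_a' has one-sided limits at a and drops there by 1. Away from a, (h h')' = h'² + V h² ≥ 0; since h
h' is integrable it is ≥ 0 on the left of a and ≤ 0 on the right, so h² peaks at a
(`sq_le_sq_of_represents`). Hence u_a = h_a / h_a(a) lies in K_a. For w in K_a, (u_a, w)_V = w(a) /
h_a(a) does not depend on w, so (w - u_a, w - u_a)_V = (w, w)_V - (u_a, u_a)_V, and u_a is the only
minimizer. The jump of u_a' is 1 / h_a(a), so u_a divided by its jump is h_a, which is the Green
function. Symmetry is h_y(x) = (h_x, h_y)_V = h_x(y). -/

/-! ### Primitives and integration by parts. -/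

/-- `U` is a primitive of the locally integrable function `g`. -/
def IsPrimitive (U g : ℝ → ℝ) : Prop :=
  LocallyIntegrable g volume ∧ ∀ a b, U b - U a = ∫ x in a..b, g x

theorem MeasureTheory.LocallyIntegrable.intervalIntegrable {g : ℝ → ℝ}
    (hg : LocallyIntegrable g volume) (a b : ℝ) : IntervalIntegrable g volume a b :=
  (hg.integrableOn_isCompact isCompact_uIcc).intervalIntegrable

theorem isPrimitive_integral {g : ℝ → ℝ} (hg : LocallyIntegrable g volume) (c d : ℝ) :
    IsPrimitive (fun x => d + ∫ t in c..x, g t) g := by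
  refine ⟨hg, fun a b => ?_⟩
  have := intervalIntegral.integral_add_adjacent_intervals
    (hg.intervalIntegrable c a) (hg.intervalIntegrable a b)
  simp only
  linarith

namespace IsPrimitive

variable {U W g k : ℝ → ℝ}

theorem eq_add (h : IsPrimitive U g) (a : ℝ) : U = fun x => U a + ∫ t in a..x, g t := by
  ext x
  rw [← h.2 a x]; ring

theorem continuous (h : IsPrimitive U g) : Continuous U := by
  rw [h.eq_add 0]
  exact continuous_const.add
    (intervalIntegral.continuous_primitive (fun a b => h.1.intervalIntegrable a b) 0)

theorem ae_hasDerivAt (h : IsPrimitive U g) : ∀ᵐ x, HasDerivAt U (g x) x := by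
  filter_upwards [_root_.LocallyIntegrable.ae_hasDerivAt_integral h.1] with x hx
  rw [h.eq_add 0]
  exact (hx 0).const_add _

theorem absolutelyContinuousOnInterval (h : IsPrimitive U g) (a b : ℝ) :
    AbsolutelyContinuousOnInterval U a b := by
  have h1 := (h.1.intervalIntegrable a b).absolutelyContinuousOnInterval_intervalIntegral
    (c := a) (by simp)
  have h2 : AbsolutelyContinuousOnInterval (fun _ : ℝ => U a) a b :=
    contDiffOn_const.absolutelyContinuousOnInterval
  rw [h.eq_add a]
  exact h2.add h1

/-- Integration by parts for primitives. -/
theorem integral_parts (h : IsPrimitive U g) (h' : IsPrimitive W k) (a b : ℝ) :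
    ∫ x in a..b, (g x * W x + U x * k x) = U b * W b - U a * W a := by
  rw [← (h.absolutelyContinuousOnInterval a b).integral_deriv_mul_eq_sub
    (h'.absolutelyContinuousOnInterval a b)]
  apply intervalIntegral.integral_congr_ae
  filter_upwards [h.ae_hasDerivAt, h'.ae_hasDerivAt] with x h1 h2 _
  rw [h1.deriv, h2.deriv]

theorem of_contDiff {φ : ℝ → ℝ} (hφ : ContDiff ℝ ∞ φ) : IsPrimitive φ (deriv φ) := by
  have hc : Continuous (deriv φ) := hφ.continuous_deriv (by simp)
  refine ⟨hc.locallyIntegrable, fun a b => ?_⟩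
  rw [intervalIntegral.integral_deriv_eq_sub (fun x _ => hφ.differentiable (by simp) x)
    (hc.intervalIntegrable a b)]

end IsPrimitive

/-! ### Weak derivatives versus primitives. -/

theorem integral_eq_intervalIntegral_of_eq_zero {f : ℝ → ℝ} {R : ℝ}
    (h : ∀ x, R ≤ |x| → f x = 0) : ∫ x, f x = ∫ x in (-R)..R, f x := by
  rw [intervalIntegral.integral_eq_integral_of_support_subset]
  intro x hx
  by_contra hn
  apply hx
  apply h
  by_contra hlt
  push Not at hlt
  rw [abs_lt] at hlt
  exact hn ⟨hlt.1, hlt.2.le⟩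

theorem HasCompactSupport.exists_eq_zero_of_le_abs {φ : ℝ → ℝ} (hc : HasCompactSupport φ) :
    ∃ R, 0 < R ∧ ∀ x, R ≤ |x| → φ x = 0 := by
  obtain ⟨R, hR, h⟩ := hc.exists_pos_le_norm
  exact ⟨R, hR, h⟩

theorem IsPrimitive.hasWeakDeriv {U g : ℝ → ℝ} (h : IsPrimitive U g) : HasWeakDeriv U g := by
  refine ⟨h.continuous.locallyIntegrable, h.1, fun φ hφ hc => ?_⟩
  have hφ' : Continuous (deriv φ) := hφ.continuous_deriv (by simp)
  have i1 : Integrable (fun x => U x * deriv φ x) :=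
    h.continuous.locallyIntegrable.integrable_smul_right_of_hasCompactSupport hφ' hc.deriv
  have i2 : Integrable (fun x => g x * φ x) :=
    h.1.integrable_smul_right_of_hasCompactSupport hφ.continuous hc
  obtain ⟨R, hR, h0⟩ := hc.exists_eq_zero_of_le_abs
  obtain ⟨R', hR', h0'⟩ := hc.deriv.exists_eq_zero_of_le_abs
  have key := h.integral_parts (IsPrimitive.of_contDiff hφ) (-max R R') (max R R')
  rw [h0 (max R R') ((le_max_left _ _).trans (le_abs_self _)),
    h0 (-max R R') (by rw [abs_neg]; exact (le_max_left _ _).trans (le_abs_self _)),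
    ← integral_eq_intervalIntegral_of_eq_zero, integral_add i2 i1] at key
  · linarith
  · intro x hx
    rw [h0 x ((le_max_left _ _).trans hx), h0' x ((le_max_right _ _).trans hx)]; ring

/-- A test function with vanishing integral is the derivative of a test function. -/
theorem exists_test_primitive {θ : ℝ → ℝ} (hθ : ContDiff ℝ ∞ θ) (hc : HasCompactSupport θ)
    (h0 : ∫ x, θ x = 0) : ∃ φ, ContDiff ℝ ∞ φ ∧ HasCompactSupport φ ∧ deriv φ = θ := by
  obtain ⟨R, hR, hz⟩ := hc.exists_eq_zero_of_le_abs
  have hd : ∀ x, HasDerivAt (fun x => ∫ t in (-R)..x, θ t) (θ x) x := fun x =>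
    intervalIntegral.integral_hasDerivAt_right (hθ.continuous.intervalIntegrable _ _)
      hθ.continuous.stronglyMeasurable.stronglyMeasurableAtFilter hθ.continuous.continuousAt
  have hde : deriv (fun x => ∫ t in (-R)..x, θ t) = θ := funext fun x => (hd x).deriv
  refine ⟨_, ?_, ?_, hde⟩
  · rw [contDiff_infty_iff_deriv, hde]
    exact ⟨fun x => (hd x).differentiableAt, hθ⟩
  · refine HasCompactSupport.intro (isCompact_Icc (a := -R) (b := R)) fun x hx => ?_
    rw [integral_eq_intervalIntegral_of_eq_zero hz] at h0
    rcases lt_or_ge x (-R) with hlt | hge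
    · refine (intervalIntegral.integral_congr (g := fun _ => 0) fun t ht => ?_).trans (by simp)
      rw [uIcc_of_ge hlt.le] at ht
      exact hz t (le_abs.2 (Or.inr (by linarith [ht.2])))
    · have hlt : R < x := by
        by_contra hn
        exact hx ⟨hge, not_lt.1 hn⟩
      rw [← intervalIntegral.integral_add_adjacent_intervals
        (hθ.continuous.intervalIntegrable (-R) R) (hθ.continuous.intervalIntegrable R x), h0,
        zero_add]
      refine (intervalIntegral.integral_congr (g := fun _ => 0) fun t ht => ?_).trans (by simp)
      rw [uIcc_of_le hlt.le] at ht
      exact hz t (le_abs.2 (Or.inl ht.1))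

/-- The du Bois-Reymond lemma. -/
theorem ae_eq_const_of_integral_mul_deriv_eq_zero {w : ℝ → ℝ} (hw : LocallyIntegrable w volume)
    (h : ∀ φ : ℝ → ℝ, ContDiff ℝ ∞ φ → HasCompactSupport φ → ∫ x, w x * deriv φ x = 0) :
    ∃ c, ∀ᵐ x, w x = c := by
  let b : ContDiffBump (0 : ℝ) := ⟨1, 2, one_pos, one_lt_two⟩
  let ρ : ℝ → ℝ := b.normed volume
  have hρ : ContDiff ℝ ∞ ρ := b.contDiff_normed
  have hρc : HasCompactSupport ρ := b.hasCompactSupport_normed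
  have hρ1 : ∫ x, ρ x = 1 := b.integral_normed
  have hi : ∀ {ψ : ℝ → ℝ}, ContDiff ℝ ∞ ψ → HasCompactSupport ψ → Integrable ψ :=
    fun h1 h2 => h1.continuous.integrable_of_hasCompactSupport h2
  have hwi : ∀ {ψ : ℝ → ℝ}, ContDiff ℝ ∞ ψ → HasCompactSupport ψ →
      Integrable (fun x => w x * ψ x) :=
    fun h1 h2 => hw.integrable_smul_right_of_hasCompactSupport h1.continuous h2
  refine ⟨∫ x, w x * ρ x, ae_eq_of_integral_contDiff_smul_eq hw
    continuous_const.locallyIntegrable fun ψ hψ hψc => ?_⟩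
  have hs : HasCompactSupport fun x => (∫ t, ψ t) * ρ x := hρc.mul_left
  -- Subtracting (∫ψ)ρ makes the mean zero, so the difference is some φ'; testing w against it gives
  -- ∫ wψ = (∫ wρ)(∫ψ).
  obtain ⟨φ, hφ, hφc, hd⟩ := exists_test_primitive
    (θ := fun x => ψ x - (∫ t, ψ t) * ρ x) (hψ.sub (contDiff_const.mul hρ))
    (hψc.sub hs) (by
      rw [integral_sub (hi hψ hψc) ((hi hρ hρc).const_mul _), integral_const_mul, hρ1]; ring)
  have key := h φ hφ hφc
  rw [hd] at key
  have e : ∀ x, w x * (ψ x - (∫ t, ψ t) * ρ x) = w x * ψ x - (∫ t, ψ t) * (w x * ρ x) :=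
    fun x => by ring
  simp only [e] at key
  rw [integral_sub (hwi hψ hψc) ((hwi hρ hρc).const_mul _), integral_const_mul] at key
  simp only [smul_eq_mul]
  rw [integral_mul_const, ← sub_eq_zero, ← key]
  simp only [mul_comm]

theorem HasWeakDeriv.exists_isPrimitive {u g : ℝ → ℝ} (h : HasWeakDeriv u g) :
    ∃ U, IsPrimitive U g ∧ u =ᵐ[volume] U := by
  have hU := isPrimitive_integral h.2.1 0 0
  obtain ⟨c, hc⟩ := ae_eq_const_of_integral_mul_deriv_eq_zero
    (h.1.sub hU.continuous.locallyIntegrable) fun φ hφ hφc => by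
      have hφ' : Continuous (deriv φ) := hφ.continuous_deriv (by simp)
      have h1 := h.2.2 φ hφ hφc
      have h2 := hU.hasWeakDeriv.2.2 φ hφ hφc
      have i1 : Integrable (fun x => u x * deriv φ x) :=
        h.1.integrable_smul_right_of_hasCompactSupport hφ' hφc.deriv
      have i2 := (hU.continuous.locallyIntegrable (μ := volume)).integrable_smul_right_of_hasCompactSupport
        hφ' hφc.deriv
      simp only [smul_eq_mul] at i2
      simp only [Pi.sub_apply, sub_mul]
      rw [integral_sub i1 i2, h1, h2]; ring
  refine ⟨_, isPrimitive_integral h.2.1 0 c, hc.mono fun x hx => ?_⟩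
  simp only [Pi.sub_apply] at hx
  linarith

/-- Two continuous functions equal almost everywhere are equal, so the fundamental theorem of
calculus holds for u itself. -/
theorem HasWeakDeriv.isPrimitive {u g : ℝ → ℝ} (h : HasWeakDeriv u g) (hu : Continuous u) :
    IsPrimitive u g := by
  obtain ⟨U, hU, e⟩ := h.exists_isPrimitive
  rwa [(hu.ae_eq_iff_eq volume hU.continuous).1 e]

/-! ### Linear structure of H¹. -/

theorem IsPrimitive.linear_comb {U W g k : ℝ → ℝ} (h : IsPrimitive U g) (h' : IsPrimitive W k)
    (c d : ℝ) : IsPrimitive (fun x => c * U x + d * W x) (fun x => c * g x + d * k x) := by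
  refine ⟨(h.1.smul c).add (h'.1.smul d), fun a b => ?_⟩
  rw [intervalIntegral.integral_add ((h.1.intervalIntegrable a b).const_mul c)
    ((h'.1.intervalIntegrable a b).const_mul d), intervalIntegral.integral_const_mul,
    intervalIntegral.integral_const_mul, ← h.2, ← h'.2]
  ring

theorem MeasureTheory.MemLp.linear_comb {f g : ℝ → ℝ} (hf : MemLp f 2 volume)
    (hg : MemLp g 2 volume) (c d : ℝ) : MemLp (fun x => c * f x + d * g x) 2 volume :=
  (hf.const_mul c).add (hg.const_mul d)

theorem HasWeakDeriv.weakDeriv {u g : ℝ → ℝ} (h : HasWeakDeriv u g) :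
    HasWeakDeriv u (weakDeriv u) := by
  have he : ∃ g, HasWeakDeriv u g := ⟨g, h⟩
  rw [_root_.weakDeriv, dif_pos he]
  exact he.choose_spec

theorem IsPrimitive.weakDeriv_ae_eq {U g : ℝ → ℝ} (h : IsPrimitive U g) :
    weakDeriv U =ᵐ[volume] g :=
  h.hasWeakDeriv.weakDeriv.ae_eq h.hasWeakDeriv

theorem IsPrimitive.memH1 {U g : ℝ → ℝ} (h : IsPrimitive U g) (hU : MemLp U 2 volume)
    (hg : MemLp g 2 volume) : MemH1 U :=
  ⟨h.continuous, hU, g, h.hasWeakDeriv, hg⟩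

namespace MemH1

variable {u v : ℝ → ℝ}

theorem isPrimitive (h : MemH1 u) : IsPrimitive u (weakDeriv u) := by
  obtain ⟨hc, -, g, hg, -⟩ := h
  exact hg.weakDeriv.isPrimitive hc

theorem memLp_weakDeriv (h : MemH1 u) : MemLp (weakDeriv u) 2 volume := by
  obtain ⟨-, -, g, hg, hg2⟩ := h
  exact hg2.ae_eq (hg.ae_eq hg.weakDeriv)

theorem linear_comb (hu : MemH1 u) (hv : MemH1 v) (c d : ℝ) :
    MemH1 (fun x => c * u x + d * v x) :=
  (hu.isPrimitive.linear_comb hv.isPrimitive c d).memH1 (hu.2.1.linear_comb hv.2.1 c d)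
    (hu.memLp_weakDeriv.linear_comb hv.memLp_weakDeriv c d)

end MemH1

theorem memH1_of_contDiff {φ : ℝ → ℝ} (hφ : ContDiff ℝ ∞ φ) (hc : HasCompactSupport φ) :
    MemH1 φ :=
  (IsPrimitive.of_contDiff hφ).memH1 (hφ.continuous.memLp_of_hasCompactSupport hc)
    ((hφ.continuous_deriv (by simp)).memLp_of_hasCompactSupport hc.deriv)

/-! ### The form (·, ·)_V. -/

section innerV

variable {V u v w : ℝ → ℝ}

theorem integrable_potential_mul (hV : MemLp V ⊤ volume) (hu : MemLp u 2 volume)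
    (hv : MemLp v 2 volume) : Integrable (fun x => V x * u x * v x) :=
  MemLp.integrable_mul (MemLp.mul' (r := 2) hu hV) hv

theorem integrable_innerV (hV : MemLp V ⊤ volume) (hu : MemH1 u) (hv : MemH1 v) :
    Integrable (fun x => weakDeriv u x * weakDeriv v x + V x * u x * v x) :=
  (hu.memLp_weakDeriv.integrable_mul hv.memLp_weakDeriv).add
    (integrable_potential_mul hV hu.2.1 hv.2.1)

theorem innerV_comm (V u v : ℝ → ℝ) : innerV V u v = innerV V v u := by
  unfold innerV
  congr 1
  ext x
  ring

theorem innerV_linear_comb_left (hV : MemLp V ⊤ volume) (hu : MemH1 u) (hv : MemH1 v)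
    (hw : MemH1 w) (c d : ℝ) :
    innerV V (fun x => c * u x + d * v x) w = c * innerV V u w + d * innerV V v w := by
  have hp := (hu.isPrimitive.linear_comb hv.isPrimitive c d).weakDeriv_ae_eq
  unfold innerV
  rw [← integral_const_mul, ← integral_const_mul,
    ← integral_add ((integrable_innerV hV hu hw).const_mul c)
      ((integrable_innerV hV hv hw).const_mul d)]
  refine integral_congr_ae (hp.mono fun x hx => ?_)
  simp only
  rw [hx]
  ring

theorem innerV_linear_comb_self (hV : MemLp V ⊤ volume) (hu : MemH1 u) (hv : MemH1 v)
    (c d : ℝ) :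
    innerV V (fun x => c * u x + d * v x) (fun x => c * u x + d * v x) =
      c ^ 2 * innerV V u u + 2 * c * d * innerV V u v + d ^ 2 * innerV V v v := by
  have hw := hu.linear_comb hv c d
  rw [innerV_linear_comb_left hV hu hv hw, innerV_comm V u, innerV_comm V v,
    innerV_linear_comb_left hV hu hv hu, innerV_linear_comb_left hV hu hv hv,
    innerV_comm V v u]
  ring

theorem innerV_self_nonneg (hpos : ∀ᵐ x, 0 < V x) (u : ℝ → ℝ) : 0 ≤ innerV V u u := by
  refine integral_nonneg_of_ae (hpos.mono fun x hx => ?_)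
  simp only [Pi.zero_apply]
  rw [mul_assoc]
  have := mul_self_nonneg (u x)
  have := mul_self_nonneg (weakDeriv u x)
  positivity

theorem eq_zero_of_innerV_self_eq_zero (hV : MemLp V ⊤ volume) (hpos : ∀ᵐ x, 0 < V x)
    (hu : MemH1 u) (h : innerV V u u = 0) : u = 0 := by
  have h0 : 0 ≤ᵐ[volume] fun x => weakDeriv u x * weakDeriv u x + V x * u x * u x :=
    hpos.mono fun x hx => by
      simp only [Pi.zero_apply]
      rw [mul_assoc]
      have := mul_self_nonneg (u x)
      have := mul_self_nonneg (weakDeriv u x)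
      positivity
  rw [innerV, integral_eq_zero_iff_of_nonneg_ae h0 (integrable_innerV hV hu hu)] at h
  rw [← hu.1.ae_eq_iff_eq volume continuous_zero]
  filter_upwards [h, hpos] with x hx hVx
  simp only [Pi.zero_apply] at hx ⊢
  by_contra hne
  have h1 := mul_self_nonneg (weakDeriv u x)
  have h2 : 0 < V x * (u x * u x) := mul_pos hVx (mul_self_pos.2 hne)
  rw [mul_assoc] at hx
  linarith

end innerV

/-! ### Riesz representation of point evaluation. -/

theorem MeasureTheory.MemLp.inner_toLp_eq_integral {f g : ℝ → ℝ} (hf : MemLp f 2 volume)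
    (hg : MemLp g 2 volume) : inner ℝ (hf.toLp f) (hg.toLp g) = ∫ x, f x * g x := by
  rw [L2.inner_def]
  refine integral_congr_ae ?_
  filter_upwards [hf.coeFn_toLp, hg.coeFn_toLp] with x h1 h2
  rw [h1, h2, RCLike.inner_apply, conj_trivial, mul_comm]

/-- The element of `L² × L²` given by two square-integrable functions. -/
noncomputable def l2Pair {p q : ℝ → ℝ} (hp : MemLp p 2 volume) (hq : MemLp q 2 volume) :
    WithLp 2 (Lp ℝ 2 (volume : Measure ℝ) × Lp ℝ 2 (volume : Measure ℝ)) :=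
  WithLp.toLp 2 (hp.toLp p, hq.toLp q)

theorem inner_l2Pair {p q p' q' : ℝ → ℝ} (hp : MemLp p 2 volume) (hq : MemLp q 2 volume)
    (hp' : MemLp p' 2 volume) (hq' : MemLp q' 2 volume) :
    inner ℝ (l2Pair hp hq) (l2Pair hp' hq') = ∫ x, (q x * q' x + p x * p' x) := by
  rw [WithLp.prod_inner_apply]
  simp only [l2Pair]
  rw [hp.inner_toLp_eq_integral hp', hq.inner_toLp_eq_integral hq', add_comm,
    ← integral_add (f := fun x => q x * q' x) (g := fun x => p x * p' x)
      (hq.integrable_mul hq') (hp.integrable_mul hp')]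

theorem exists_eq_l2Pair
    (z : WithLp 2 (Lp ℝ 2 (volume : Measure ℝ) × Lp ℝ 2 (volume : Measure ℝ))) :
    ∃ (p q : ℝ → ℝ) (hp : MemLp p 2 volume) (hq : MemLp q 2 volume), z = l2Pair hp hq := by
  refine ⟨z.fst, z.snd, Lp.memLp _, Lp.memLp _, ?_⟩
  simp only [l2Pair, Lp.toLp_coeFn]
  rfl

theorem Submodule.mem_orthogonal_span {E : Type*} [NormedAddCommGroup E] [InnerProductSpace ℝ E]
    {T : Set E} {v : E} : v ∈ (Submodule.span ℝ T)ᗮ ↔ ∀ t ∈ T, inner ℝ t v = 0 := by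
  refine ⟨fun h t ht => h t (Submodule.subset_span ht), fun h => ?_⟩
  rw [Submodule.mem_orthogonal]
  intro u hu
  induction hu using Submodule.span_induction with
  | mem x hx => exact h x hx
  | zero => simp
  | add x y _ _ h1 h2 => rw [inner_add_left, h1, h2, add_zero]
  | smul a x _ h1 => rw [inner_smul_left, h1, mul_zero]

/-- z is the orthogonal projection of a onto Kᗮ, which is closed whether or not K is. -/
theorem Submodule.exists_mem_orthogonal_inner_eq {E : Type*} [NormedAddCommGroup E]
    [InnerProductSpace ℝ E] [CompleteSpace E] (K : Submodule ℝ E) (a : E) :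
    ∃ z ∈ Kᗮ, ∀ w ∈ Kᗮ, inner ℝ z w = inner ℝ a w := by
  obtain ⟨z, hz, z', hz', rfl⟩ := Submodule.exists_add_mem_mem_orthogonal (K := Kᗮ) a
  refine ⟨z, hz, fun w hw => ?_⟩
  rw [inner_add_left, real_inner_comm w z', hz' w hw, add_zero]

theorem memLp_top_sqrt {V : ℝ → ℝ} {v₁ : ℝ} (hV : MemLp V ⊤ volume)
    (hbd : ∀ᵐ x, V x ≤ v₁) : MemLp (fun x => √(V x)) ⊤ volume := by
  refine memLp_top_of_bound
    (Real.continuous_sqrt.comp_aestronglyMeasurable hV.aestronglyMeasurable) (√v₁) ?_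
  filter_upwards [hbd] with x hx
  rw [Real.norm_of_nonneg (Real.sqrt_nonneg _)]
  exact Real.sqrt_le_sqrt hx

theorem memLp_top_inv_sqrt {V : ℝ → ℝ} {v₀ : ℝ} (hv₀ : 0 < v₀) (hV : MemLp V ⊤ volume)
    (hbd : ∀ᵐ x, v₀ ≤ V x) : MemLp (fun x => (√(V x))⁻¹) ⊤ volume := by
  refine memLp_top_of_bound
    (Real.continuous_sqrt.comp_aestronglyMeasurable
      hV.aestronglyMeasurable).aemeasurable.inv.aestronglyMeasurable (√v₀)⁻¹ ?_
  filter_upwards [hbd] with x hx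
  rw [Real.norm_of_nonneg (inv_nonneg.2 (Real.sqrt_nonneg _))]
  exact inv_anti₀ (Real.sqrt_pos.2 hv₀) (Real.sqrt_le_sqrt hx)

/-- Integrate ((t - y - 1) v)' over [y, y + 1]: the weight is -1 at y and 0 at y + 1. This writes
evaluation as a pairing of v' and v with fixed L² functions, so no Sobolev inequality is needed. -/
theorem IsPrimitive.eval_eq_integral {v g : ℝ → ℝ} (h : IsPrimitive v g) (y : ℝ) :
    v y = ∫ x, ((Ioc y (y + 1)).indicator (fun t => t - y - 1) x * g x +
      (Ioc y (y + 1)).indicator 1 x * v x) := by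
  have hl : IsPrimitive (fun t => t - y - 1) 1 := by
    refine ⟨continuous_one.locallyIntegrable, fun a b => ?_⟩
    simp
  have key := hl.integral_parts h y (y + 1)
  have e : ∀ x, (Ioc y (y + 1)).indicator (fun t => t - y - 1) x * g x +
      (Ioc y (y + 1)).indicator 1 x * v x =
      (Ioc y (y + 1)).indicator (fun t => (1 : ℝ → ℝ) t * v t + (t - y - 1) * g t) x := by
    intro x
    by_cases hx : x ∈ Ioc y (y + 1)
    · simp [hx]; ring
    · simp [hx]
  simp only [e]
  rw [integral_indicator measurableSet_Ioc, ← intervalIntegral.integral_of_le (by linarith), key]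
  ring

/-- Point evaluation on `H¹(ℝ)` is represented by an element of `H¹(ℝ)` with respect to the
inner product `(·, ·)_V`. -/
theorem exists_representer {V : ℝ → ℝ} {v₀ v₁ : ℝ} (hv₀ : 0 < v₀)
    (hV : MemLp V ⊤ volume) (hbd : ∀ᵐ x, v₀ ≤ V x ∧ V x ≤ v₁) (y : ℝ) :
    ∃ h, MemH1 h ∧ ∀ v, MemH1 v → innerV V h v = v y := by
  have hs := memLp_top_sqrt hV (hbd.mono fun _ h => h.2)
  have hi := memLp_top_inv_sqrt hv₀ hV (hbd.mono fun _ h => h.1)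
  have hsi : ∀ᵐ x, √(V x) * (√(V x))⁻¹ = 1 ∧ √(V x) * √(V x) = V x := hbd.mono fun x hx =>
    ⟨mul_inv_cancel₀ (Real.sqrt_pos.2 (hv₀.trans_le hx.1)).ne',
      Real.mul_self_sqrt (hv₀.le.trans hx.1)⟩
  -- The map u ↦ (√V u, u') turns (·, ·)_V into the inner product of L² × L².
  let emb (u : ℝ → ℝ) (hu : MemH1 u) :=
    l2Pair (MemLp.mul' (r := 2) hu.2.1 hs) hu.memLp_weakDeriv
  -- Orthogonality of (p, q) to every (φ'/√V, φ) says exactly that q is a weak derivative of p/√V;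
  -- so the complement of T is the image of H¹.
  let T : Set (WithLp 2 (Lp ℝ 2 (volume : Measure ℝ) × Lp ℝ 2 (volume : Measure ℝ))) :=
    {z | ∃ (φ : ℝ → ℝ) (_ : ContDiff ℝ ∞ φ) (_ : HasCompactSupport φ)
      (h1 : MemLp (fun x => (√(V x))⁻¹ * deriv φ x) 2 volume) (h2 : MemLp φ 2 volume),
      z = l2Pair h1 h2}
  have hemb : ∀ u hu, emb u hu ∈ (Submodule.span ℝ T)ᗮ := by
    intro u hu
    rw [Submodule.mem_orthogonal_span]
    rintro _ ⟨φ, hφ, hc, h1, h2, rfl⟩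
    have hw := hu.isPrimitive.hasWeakDeriv.2.2 φ hφ hc
    rw [inner_l2Pair]
    have i1 : Integrable (fun x => u x * deriv φ x) :=
      hu.isPrimitive.hasWeakDeriv.1.integrable_smul_right_of_hasCompactSupport
        (hφ.continuous_deriv (by simp)) hc.deriv
    have i2 : Integrable (fun x => weakDeriv u x * φ x) :=
      hu.isPrimitive.1.integrable_smul_right_of_hasCompactSupport hφ.continuous hc
    have e : ∫ x, (φ x * weakDeriv u x + (√(V x))⁻¹ * deriv φ x * (√(V x) * u x)) =
        ∫ x, (weakDeriv u x * φ x + u x * deriv φ x) := by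
      refine integral_congr_ae (hsi.mono fun x hx => ?_)
      simp only
      linear_combination (deriv φ x * u x) * hx.1
    rw [e, integral_add i2 i1, hw, add_neg_cancel]
  have hA : MemLp ((Ioc y (y + 1)).indicator (1 : ℝ → ℝ)) 2 volume :=
    memLp_indicator_const 2 measurableSet_Ioc 1 (Or.inr (by simp))
  have hB : MemLp ((Ioc y (y + 1)).indicator (fun t => t - y - 1)) 2 volume := by
    have hc : Continuous fun t : ℝ => t - y - 1 := by fun_prop
    rw [memLp_indicator_iff_restrict measurableSet_Ioc]
    refine (MemLp.of_bound (hc.aestronglyMeasurable) 1 ?_)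
    refine (ae_restrict_mem measurableSet_Ioc).mono fun x hx => ?_
    rw [Real.norm_eq_abs, abs_le]
    constructor <;> linarith [hx.1, hx.2]
  -- This pair represents evaluation at y but need not come from H¹; its projection does, with the
  -- same products against the image of H¹.
  obtain ⟨z, hz, hz'⟩ := (Submodule.span ℝ T).exists_mem_orthogonal_inner_eq
    (l2Pair (MemLp.mul' (r := 2) hA hi) hB)
  obtain ⟨p, q, hp, hq, rfl⟩ := exists_eq_l2Pair z
  have hp2 : MemLp (fun x => (√(V x))⁻¹ * p x) 2 volume := MemLp.mul' hp hi
  have hw : HasWeakDeriv (fun x => (√(V x))⁻¹ * p x) q := by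
    refine ⟨hp2.locallyIntegrable (by simp), hq.locallyIntegrable (by simp),
      fun φ hφ hc => ?_⟩
    have h1 : MemLp (deriv φ) 2 volume :=
      (hφ.continuous_deriv (by simp)).memLp_of_hasCompactSupport hc.deriv
    have h2 : MemLp φ 2 volume := hφ.continuous.memLp_of_hasCompactSupport hc
    have h3 : MemLp (fun x => (√(V x))⁻¹ * deriv φ x) 2 volume := MemLp.mul' h1 hi
    have := (Submodule.mem_orthogonal_span.1 hz) _ ⟨φ, hφ, hc, h3, h2, rfl⟩
    rw [inner_l2Pair, integral_add (f := fun x => φ x * q x)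
      (g := fun x => (√(V x))⁻¹ * deriv φ x * p x)
      (h2.integrable_mul hq) (h3.integrable_mul hp)] at this
    rw [eq_neg_iff_add_eq_zero, add_comm, ← this]
    congr 1
    · simp only [mul_comm]
    · congr 1
      ext x
      ring
  obtain ⟨U, hU, he⟩ := hw.exists_isPrimitive
  have hUm : MemH1 U := hU.memH1 (hp2.ae_eq he) hq
  refine ⟨U, hUm, fun v hv => ?_⟩
  have e1 : innerV V U v = inner ℝ (l2Pair hp hq) (emb v hv) := by
    rw [inner_l2Pair]
    refine integral_congr_ae ?_
    filter_upwards [hU.weakDeriv_ae_eq, he, hsi] with x h1 h2 h3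
    rw [h1, ← h2]
    linear_combination (√(V x) * p x * v x) * h3.1 - ((√(V x))⁻¹ * p x * v x) * h3.2
  have e2 : inner ℝ (l2Pair (MemLp.mul' (r := 2) hA hi) hB) (emb v hv) = v y := by
    rw [inner_l2Pair, hv.isPrimitive.eval_eq_integral y]
    refine integral_congr_ae (hsi.mono fun x h3 => ?_)
    simp only
    linear_combination ((Ioc y (y + 1)).indicator 1 x * v x) * h3.1
  rw [e1, ← e2, hz' _ (hemb v hv)]

/-! ### Behaviour at the pole. -/

/-- Away from the pole, a function representing point evaluation at `a` has an absolutely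
continuous derivative, which drops by `1` at `a`. -/
theorem exists_isPrimitive_of_represents {V h : ℝ → ℝ} {a : ℝ} (hV : MemLp V ⊤ volume)
    (hh : MemH1 h) (hrep : ∀ v, MemH1 v → innerV V h v = v a) :
    ∃ P, IsPrimitive P (fun x => V x * h x) ∧
      ∀ᵐ x, weakDeriv h x = P x - (Ioi a).indicator 1 x := by
  have hθ : LocallyIntegrable ((Ioi a).indicator (1 : ℝ → ℝ)) volume :=
    continuous_one.locallyIntegrable.indicator measurableSet_Ioi
  have hVh : MemLp (fun x => V x * h x) 2 volume := MemLp.mul' hh.2.1 hV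
  -- Since h'' = V h - δ_a weakly, adding the Heaviside function at a to h' cancels the Dirac mass.
  have hw : HasWeakDeriv (fun x => weakDeriv h x + (Ioi a).indicator 1 x)
      (fun x => V x * h x) := by
    refine ⟨hh.isPrimitive.1.add hθ, hVh.locallyIntegrable (by simp), fun φ hφ hc => ?_⟩
    have hφ' : Continuous (deriv φ) := hφ.continuous_deriv (by simp)
    have hφm := memH1_of_contDiff hφ hc
    have hφd := (IsPrimitive.of_contDiff hφ).weakDeriv_ae_eq
    have i1 : Integrable (fun x => weakDeriv h x * deriv φ x) :=
      hh.isPrimitive.1.integrable_smul_right_of_hasCompactSupport hφ' hc.deriv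
    have i2 : Integrable (fun x => (Ioi a).indicator 1 x * deriv φ x) :=
      hθ.integrable_smul_right_of_hasCompactSupport hφ' hc.deriv
    have i3 := integrable_potential_mul hV hh.2.1 hφm.2.1
    have e1 : innerV V h φ = ∫ x, (weakDeriv h x * deriv φ x + V x * h x * φ x) :=
      integral_congr_ae (hφd.mono fun x hx => by simp only; rw [hx])
    have e2 : ∫ x, (Ioi a).indicator 1 x * deriv φ x = -φ a := by
      rw [← hc.integral_Ioi_deriv_eq (hφ.of_le (by simp)) a,
        ← integral_indicator measurableSet_Ioi]
      congr 1
      ext x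
      by_cases hx : x ∈ Ioi a
      · rw [indicator_of_mem hx, indicator_of_mem hx, Pi.one_apply, one_mul]
      · rw [indicator_of_notMem hx, indicator_of_notMem hx, zero_mul]
    have e3 := hrep φ hφm
    rw [e1, integral_add i1 i3] at e3
    simp only [add_mul]
    rw [integral_add i1 i2, e2]
    linarith
  obtain ⟨P, hP, he⟩ := hw.exists_isPrimitive
  exact ⟨P, hP, he.mono fun x hx => by rw [← hx]; ring⟩

/-- On s, h coincides with the C¹ function h(a) + ∫ₐˣ Q, so a one-sided s yields a one-sided
derivative. -/
theorem IsPrimitive.hasDerivWithinAt {h w Q : ℝ → ℝ} {a : ℝ} {s : Set ℝ} (hh : IsPrimitive h w)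
    (hQ : Continuous Q) (he : ∀ x ∈ s, ∀ᵐ t, t ∈ uIoc a x → w t = Q t) :
    HasDerivWithinAt h (Q a) s a := by
  have hd : HasDerivAt (fun x => h a + ∫ t in a..x, Q t) (Q a) a :=
    (intervalIntegral.integral_hasDerivAt_right (hQ.intervalIntegrable _ _)
      hQ.stronglyMeasurable.stronglyMeasurableAtFilter hQ.continuousAt).const_add _
  refine hd.hasDerivWithinAt.congr (fun x hx => ?_) (by simp)
  rw [← intervalIntegral.integral_congr_ae (he x hx), ← hh.2 a x]
  ring

/-! ### Monotonicity of h h' and the maximum at the pole. -/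

/-- A positive value would bound E from below on a half-line of infinite measure, against
integrability. -/
theorem nonpos_of_monotoneOn_Ici {E : ℝ → ℝ} {a : ℝ} (hE : MonotoneOn E (Ici a))
    (hi : IntegrableOn E (Ici a)) : ∀ x ∈ Ici a, E x ≤ 0 := by
  intro x hx
  by_contra! hpos
  have hsub : Ici x ⊆ Ici a := Ici_subset_Ici.2 hx
  have : IntegrableOn (fun _ => E x) (Ici x) := by
    refine (hi.mono_set hsub).mono' aestronglyMeasurable_const ?_
    refine (ae_restrict_mem measurableSet_Ici).mono fun t ht => ?_
    rw [Real.norm_of_nonneg hpos.le]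
    exact hE hx (hsub ht) ht
  rw [integrableOn_const_iff] at this
  simp [hpos.ne'] at this

theorem nonneg_of_monotoneOn_Iic {E : ℝ → ℝ} {a : ℝ} (hE : MonotoneOn E (Iic a))
    (hi : IntegrableOn E (Iic a)) : ∀ x ∈ Iic a, 0 ≤ E x := by
  intro x hx
  have h1 : MonotoneOn (fun x => -E (-x)) (Ici (-a)) := fun s hs t ht hst =>
    neg_le_neg (hE (mem_Iic.2 (neg_le.1 ht)) (mem_Iic.2 (neg_le.1 hs)) (neg_le_neg hst))
  have h2 : IntegrableOn (fun x => -E (-x)) (Ici (-a)) := by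
    refine Integrable.neg ?_
    have := (Measure.measurePreserving_neg (volume : Measure ℝ)).integrableOn_comp_preimage
      (MeasurableEquiv.neg ℝ).measurableEmbedding (f := E) (s := Iic a)
    rw [← this] at hi
    simpa [IntegrableOn, Function.comp_def] using hi
  have := nonpos_of_monotoneOn_Ici h1 h2 (-x) (mem_Ici.2 (neg_le_neg hx))
  simp only [neg_neg] at this
  linarith

section decay

variable {h w Q k : ℝ → ℝ} {a : ℝ}

/-- Where h' = Q, (h Q)' = Q² + h k ≥ 0. Using the continuous Q in place of h' makes the
monotonicity hold pointwise. -/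
theorem IsPrimitive.monotoneOn_mul {s : Set ℝ} [s.OrdConnected] (hh : IsPrimitive h w)
    (hQ : IsPrimitive Q k) (he : ∀ᵐ x, x ∈ s → w x = Q x) (hk : ∀ᵐ x, 0 ≤ h x * k x) :
    MonotoneOn (fun x => h x * Q x) s := by
  intro c hc d hd hcd
  rw [← sub_nonneg, ← hh.integral_parts hQ c d]
  refine intervalIntegral.integral_nonneg_of_ae_restrict hcd ?_
  filter_upwards [ae_restrict_of_ae he, ae_restrict_of_ae hk, ae_restrict_mem measurableSet_Icc]
    with x h1 h2 h3
  rw [h1 (Set.OrdConnected.out inferInstance hc hd h3)]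
  exact add_nonneg (mul_self_nonneg _) h2

theorem IsPrimitive.sq_sub_sq (hh : IsPrimitive h w) {c d : ℝ}
    (he : ∀ᵐ x, x ∈ uIoc c d → w x = Q x) :
    h d ^ 2 - h c ^ 2 = ∫ x in c..d, 2 * (h x * Q x) := by
  rw [sq, sq, ← hh.integral_parts hh c d]
  refine intervalIntegral.integral_congr_ae (he.mono fun x hx hm => ?_)
  rw [hx hm]
  ring

end decay

/-- A function representing point evaluation at `a` attains its maximal modulus at `a`. -/
theorem sq_le_sq_of_represents {V h : ℝ → ℝ} {a : ℝ} (hV : MemLp V ⊤ volume)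
    (hpos : ∀ᵐ x, 0 < V x) (hh : MemH1 h) (hrep : ∀ v, MemH1 v → innerV V h v = v a) (x : ℝ) :
    h x ^ 2 ≤ h a ^ 2 := by
  obtain ⟨P, hP, he⟩ := exists_isPrimitive_of_represents hV hh hrep
  have hk : ∀ᵐ x, 0 ≤ h x * (V x * h x) := hpos.mono fun x hx => by
    rw [mul_left_comm]
    exact mul_nonneg hx.le (mul_self_nonneg _)
  have hint : Integrable (fun x => h x * weakDeriv h x) :=
    hh.2.1.integrable_mul hh.memLp_weakDeriv
  rcases le_or_gt x a with hx | hx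
  · have e : ∀ᵐ t, t ∈ Iic a → weakDeriv h t = P t := he.mono fun t ht hta => by
      rw [ht, indicator_of_notMem (notMem_Ioi.2 hta), sub_zero]
    have hE := nonneg_of_monotoneOn_Iic (hh.isPrimitive.monotoneOn_mul hP e hk)
      (hint.integrableOn.congr ((ae_restrict_iff' measurableSet_Iic).2
        (e.mono fun t ht hta => by simp only; rw [ht hta])))
    have := hh.isPrimitive.sq_sub_sq (Q := P) (c := x) (d := a)
      (e.mono fun t ht hta => ht (by rw [uIoc_of_le hx] at hta; exact hta.2))
    have h2 : 0 ≤ ∫ t in x..a, 2 * (h t * P t) :=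
      intervalIntegral.integral_nonneg hx fun t ht => mul_nonneg two_pos.le (hE t ht.2)
    linarith
  · have hQ : IsPrimitive (fun t => P t - 1) (fun x => V x * h x) :=
      ⟨hP.1, fun c d => by rw [← hP.2 c d]; ring⟩
    have e : ∀ᵐ t, t ∈ Ioi a → weakDeriv h t = P t - 1 := he.mono fun t ht hta => by
      rw [ht, indicator_of_mem hta, Pi.one_apply]
    have e' : ∀ᵐ t, t ∈ Ici a → weakDeriv h t = P t - 1 := by
      filter_upwards [e, compl_mem_ae_iff.2 (measure_singleton a)] with t ht hne hta
      exact ht (lt_of_le_of_ne hta (Ne.symm hne))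
    have hE := nonpos_of_monotoneOn_Ici (hh.isPrimitive.monotoneOn_mul hQ e' hk)
      (hint.integrableOn.congr ((ae_restrict_iff' measurableSet_Ici).2
        (e'.mono fun t ht hta => by simp only; rw [ht hta])))
    have := hh.isPrimitive.sq_sub_sq (Q := fun t => P t - 1) (c := a) (d := x)
      (e.mono fun t ht hta => ht (by rw [uIoc_of_le hx.le] at hta; exact hta.1))
    have h2 : 0 ≤ ∫ t in a..x, -(2 * (h t * (P t - 1))) :=
      intervalIntegral.integral_nonneg hx.le fun t ht => by
        have := hE t ht.1
        linarith
    rw [intervalIntegral.integral_neg] at h2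
    linarith

/-- One-sided derivatives at `a` of a function representing point evaluation at `a`. -/
theorem exists_hasDerivWithinAt_of_represents {V h : ℝ → ℝ} {a : ℝ} (hV : MemLp V ⊤ volume)
    (hh : MemH1 h) (hrep : ∀ v, MemH1 v → innerV V h v = v a) :
    ∃ p, HasDerivWithinAt h p (Iio a) a ∧ HasDerivWithinAt h (p - 1) (Ioi a) a := by
  obtain ⟨P, hP, he⟩ := exists_isPrimitive_of_represents hV hh hrep
  refine ⟨P a, hh.isPrimitive.hasDerivWithinAt hP.continuous fun x hx => ?_,
    hh.isPrimitive.hasDerivWithinAt (Q := fun t => P t - 1) (hP.continuous.sub continuous_const)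
      fun x hx => ?_⟩
  · refine he.mono fun t ht hm => ?_
    rw [uIoc_of_ge (le_of_lt hx)] at hm
    rw [ht, indicator_of_notMem (notMem_Ioi.2 hm.2), sub_zero]
  · refine he.mono fun t ht hm => ?_
    rw [uIoc_of_le (le_of_lt hx)] at hm
    rw [ht, indicator_of_mem (show t ∈ Ioi a from hm.1), Pi.one_apply]

theorem eq_of_represents {V h h' : ℝ → ℝ} {a : ℝ} (hV : MemLp V ⊤ volume)
    (hpos : ∀ᵐ x, 0 < V x) (hh : MemH1 h) (hrep : ∀ v, MemH1 v → innerV V h v = v a)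
    (hh' : MemH1 h') (hrep' : ∀ v, MemH1 v → innerV V h' v = v a) : h = h' := by
  have hm := hh.linear_comb hh' 1 (-1)
  have h0 := eq_zero_of_innerV_self_eq_zero hV hpos hm (by
    rw [innerV_linear_comb_left hV hh hh' hm, hrep _ hm, hrep' _ hm]; ring)
  ext x
  have := congrFun h0 x
  simp only [Pi.zero_apply] at this
  linarith

theorem represents_self_pos {V h : ℝ → ℝ} {a : ℝ} (hV : MemLp V ⊤ volume)
    (hpos : ∀ᵐ x, 0 < V x) (hh : MemH1 h) (hrep : ∀ v, MemH1 v → innerV V h v = v a) :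
    0 < h a := by
  have hnn := innerV_self_nonneg hpos h
  rw [hrep h hh] at hnn
  -- If h(a) = (h, h)_V were 0 then h = 0, whose derivative cannot drop by 1 at a.
  refine lt_of_le_of_ne hnn fun h0 => ?_
  have hz := eq_zero_of_innerV_self_eq_zero hV hpos hh (by rw [hrep h hh, h0])
  obtain ⟨p, h1, h2⟩ := exists_hasDerivWithinAt_of_represents hV hh hrep
  rw [hz] at h1 h2
  have e1 := (uniqueDiffWithinAt_Iio a).eq_deriv _ h1 (hasDerivWithinAt_const a _ (0 : ℝ))
  have e2 := (uniqueDiffWithinAt_Ioi a).eq_deriv _ h2 (hasDerivWithinAt_const a _ (0 : ℝ))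
  linarith

/-- The set where the bound holds has full measure, hence is dense, and is closed by continuity. -/
theorem Continuous.enorm_le_eLpNorm_top {f : ℝ → ℝ} (hf : Continuous f) (x : ℝ) :
    ‖f x‖ₑ ≤ eLpNorm f ⊤ volume := by
  rw [eLpNorm_exponent_top]
  have hd : Dense {x | ‖f x‖ₑ ≤ eLpNormEssSup f volume} :=
    Measure.dense_of_ae (μ := volume) (ae_le_eLpNormEssSup (f := f))
  have hc : IsClosed {x | ‖f x‖ₑ ≤ eLpNormEssSup f volume} :=
    isClosed_le hf.enorm continuous_const
  have := hd.closure_eq ▸ mem_univ x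
  rwa [hc.closure_eq] at this

/-! ### Minimizers and the Green function. -/

/-- A function in `K_a` representing a multiple of point evaluation at `a` is the unique
minimizer of `‖·‖_V²` over `K_a`. -/
theorem isPeakMinimizer_iff_eq {V u : ℝ → ℝ} {a c : ℝ} (hV : MemLp V ⊤ volume)
    (hpos : ∀ᵐ x, 0 < V x) (hu : u ∈ peakSet a) (hrep : ∀ v, MemH1 v → innerV V u v = c * v a)
    (w : ℝ → ℝ) : IsPeakMinimizer V a w ↔ w = u := by
  -- The cross term is (u, w)_V = c w(a) = c = (u, u)_V, since every member of K_a is 1 at a.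
  have key : ∀ w ∈ peakSet a,
      innerV V (fun x => 1 * w x + -1 * u x) (fun x => 1 * w x + -1 * u x) =
        innerV V w w - innerV V u u := by
    intro w hw
    rw [innerV_linear_comb_self hV hw.1 hu.1, innerV_comm V w u, hrep w hw.1, hrep u hu.1,
      hw.2.1, hu.2.1]
    ring
  have hmin : ∀ w ∈ peakSet a, innerV V u u ≤ innerV V w w := fun w hw => by
    have := innerV_self_nonneg hpos (fun x => 1 * w x + -1 * u x)
    rw [key w hw] at this
    linarith
  refine ⟨fun ⟨hw, hle⟩ => ?_, fun h => h ▸ ⟨hu, hmin⟩⟩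
  have h0 := eq_zero_of_innerV_self_eq_zero hV hpos (hw.1.linear_comb hu.1 1 (-1)) (by
    rw [key w hw, le_antisymm (hle u hu) (hmin w hw), sub_self])
  ext x
  have := congrFun h0 x
  simp only [Pi.zero_apply] at this
  linarith

theorem mainTheorem11 (V : ℝ → ℝ) (v₀ v₁ : ℝ) (hv₀ : 0 < v₀)
    (hV : MemLp V ⊤ volume) (hbd : ∀ᵐ x, v₀ ≤ V x ∧ V x ≤ v₁) :
    ∃ u : ℝ → ℝ → ℝ,
      (∀ (a : ℝ) (w : ℝ → ℝ), IsPeakMinimizer V a w ↔ w = u a) ∧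
      (∀ a : ℝ, DifferentiableWithinAt ℝ (u a) (Iio a) a ∧
        DifferentiableWithinAt ℝ (u a) (Ioi a) a ∧ derivJump (u a) a ≠ 0) ∧
      ∃ G : ℝ → ℝ → ℝ,
        (∀ H : ℝ → ℝ → ℝ, IsGreenFunction V H ↔ H = G) ∧
        (∀ x y : ℝ, G x y = u y x / derivJump (u y) y) ∧
        (∀ x y : ℝ, G x y = u x y / derivJump (u x) x) ∧
        (∀ x y : ℝ, G x y = G y x) := by
  have hpos : ∀ᵐ x, 0 < V x := hbd.mono fun x hx => hv₀.trans_le hx.1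
  choose h hh hrep using exists_representer hv₀ hV hbd
  have hp : ∀ a, 0 < h a a := fun a => represents_self_pos hV hpos (hh a) (hrep a)
  have hsymm : ∀ x y, h y x = h x y := fun x y => by
    rw [← hrep x (h y) (hh y), innerV_comm, hrep y (h x) (hh x)]
  choose p hl hr using fun a => exists_hasDerivWithinAt_of_represents hV (hh a) (hrep a)
  let u : ℝ → ℝ → ℝ := fun a x => (h a a)⁻¹ * h a x
  have hul : ∀ a, HasDerivWithinAt (u a) ((h a a)⁻¹ * p a) (Iio a) a :=
    fun a => (hl a).const_mul _
  have hur : ∀ a, HasDerivWithinAt (u a) ((h a a)⁻¹ * (p a - 1)) (Ioi a) a :=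
    fun a => (hr a).const_mul _
  -- The slopes p and p - 1 differ by 1, so only the normalizing factor remains.
  have hjump : ∀ a, derivJump (u a) a = (h a a)⁻¹ := fun a => by
    rw [derivJump, (hul a).derivWithin (uniqueDiffWithinAt_Iio a),
      (hur a).derivWithin (uniqueDiffWithinAt_Ioi a)]
    ring
  have hquot : ∀ x y, h y x = u y x / derivJump (u y) y := fun x y => by
    rw [hjump, div_inv_eq_mul, mul_comm, mul_inv_cancel_left₀ (hp y).ne']
  have hu : ∀ a, MemH1 (u a) ∧ ∀ v, MemH1 v → innerV V (u a) v = (h a a)⁻¹ * v a := fun a => by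
    -- The zero term only brings u a to the shape of a linear combination.
    have e : u a = fun x => (h a a)⁻¹ * h a x + 0 * h a x := by
      ext x
      simp [u]
    rw [e]
    refine ⟨(hh a).linear_comb (hh a) _ _, fun v hv => ?_⟩
    rw [innerV_linear_comb_left hV (hh a) (hh a) hv, hrep a v hv]
    ring
  have hu1 : ∀ a, u a a = 1 := fun a => inv_mul_cancel₀ (hp a).ne'
  have hpeak : ∀ a, u a ∈ peakSet a := fun a => by
    refine ⟨(hu a).1, hu1 a, le_antisymm ?_ ?_⟩
    · rw [eLpNorm_exponent_top, ← ENNReal.ofReal_one]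
      refine eLpNormEssSup_le_of_ae_bound (Filter.Eventually.of_forall fun x => ?_)
      have hx := abs_le_of_sq_le_sq (sq_le_sq_of_represents hV hpos (hh a) (hrep a) x) (hp a).le
      rw [Real.norm_eq_abs, abs_mul, abs_of_pos (inv_pos.2 (hp a)), inv_mul_le_one₀ (hp a)]
      exact hx
    · have := (hu a).1.1.enorm_le_eLpNorm_top a
      rwa [hu1 a, enorm_one] at this
  refine ⟨u, fun a => isPeakMinimizer_iff_eq hV hpos (hpeak a) (hu a).2,
    fun a => ⟨(hul a).differentiableWithinAt, (hur a).differentiableWithinAt, ?_⟩,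
    fun x y => h y x, fun H => ⟨fun hH => ?_, ?_⟩, hquot, fun x y => ?_, fun x y => hsymm x y⟩
  · rw [hjump]
    exact (inv_pos.2 (hp a)).ne'
  · ext x y
    exact congrFun (eq_of_represents hV hpos (hH y).1 (hH y).2 (hh y) (hrep y)) x
  · rintro rfl y
    exact ⟨hh y, hrep y⟩
  · exact (hsymm x y).trans (hquot y x)
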